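/- **Setting.** Let $V_J=\{\mathcal H_r,\ r\in J\}$ be a lattice of Hilbert spaces (LHS): $V$ is a complex vector space with a symmetric linear compatibility relation $\#$ and a nondegenerate, positive definite partial inner product $\langle\cdot|\cdot\rangle$ defined exactly on compatible pairs; the $\mathcal H_r$ form a generating involutive sublattice of the lattice of assaying subspaces ($S^{\#\#}=S$), with $p\le q\Leftrightarrow\mathcal H_p\subseteq\mathcal H_q$ and $\mathcal H_{\bar r}=\mathcal H_r^{\#}$; every $\mathcal H_r$ is a Hilbert space whose conjugate dual, with the dual norm, is $\mathcal H_{\bar r}$ via $\langle\cdot|\cdot\rangle$; and there is a unique self-dual space $\mathcal H_0=\mathcal H_{\bar 0}$, on which $\langle\cdot|\cdot\rangle$ is the Hilbert space inner product. An operator $X\in\mathrm{Op}(V_J)$ is a map whose domain is a union of spaces $\mathcal H_q$ over a nonempty set of indices $q$, that maps each of these $\mathcal H_q$ linearly and continuously into some $\mathcal H_p$, and that has no proper extension of this kind. If $X$ maps $\mathcal H_q$ continuously into $\mathcal H_p$, the restriction $X_{pq}:\mathcal H_q\to\mathcal H_p$ is called a representative. $X$ is symmetric if $X=X^\times$, i.e.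 if for every representative $X_{pq}$ the representative $X_{\bar q\bar p}$ exists and is its adjoint map with respect to $\langle\cdot|\cdot\rangle$. $E_{nm}$ denotes the inclusion $\mathcal H_m\to\mathcal H_n$ if $\mathcal H_m\subseteq\mathcal H_n$. **Corollary.** Let the LHS $V_J$ be a chain, i.e. any two of the spaces $\mathcal H_r$ are comparable. Let $X=X^\times\in\mathrm{Op}(V_J)$, and suppose that for some $\lambda\in\mathbb R$ and some representative $X_{nm}$ with $\mathcal H_m\subseteq\mathcal H_n$ the map $X_{nm}-\lambda E_{nm}:\mathcal H_m\to\mathcal H_n$ is bijective. Then: - The inverse $R_{mn}=(X_{nm}-\lambda E_{nm})^{-1}:\mathcal H_n\to\mathcal H_m$ is a representative of an operator $R\in\mathrm{Op}(V_J)$ that also has a representative $R_{00}:\mathcal H_0\to\mathcal H_0$; there is exactly one operator $X_0$ in $\mathcal H_0$ such that $X_0-\lambda I=(R_{00})^{-1}$; this $X_0$ is densely defined and self-adjoint, and $\lambda$ does not belong to its spectrum. - At least one of the following four cases holds: (ia) $m\le n\le 0\le\bar n\le\bar m$; (ib) $m\le\bar n\le 0\le n\le\bar m$; (iia) $\bar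 n\le m\le 0\le\bar m\le n$; (iib) $\bar n\le\bar m\le 0\le m\le n$. - In each case $X_0$ is obtained by restriction: - in case (ia), $X_0$ is the unique restriction of $X_{\bar m0}:\mathcal H_0\to\mathcal H_{\bar m}$ to a self-adjoint operator in $\mathcal H_0$, its domain is $D(X_0)=\{f\in\mathcal H_0: Xf\in\mathcal H_0\}$, and $\mathcal H_m\subset D(X_0)\subset\mathcal H_0$; - in cases (ib) and (iia), $X_0$ is the unique restriction of $X_{\bar m\bar n}:\mathcal H_{\bar n}\to\mathcal H_{\bar m}$, and also the unique restriction of $X_{nm}:\mathcal H_m\to\mathcal H_n$, to a self-adjoint operator in $\mathcal H_0$, and $D(X_0)=\{f\in\mathcal H_{\bar n}: Xf\in\mathcal H_0\}=\{f\in\mathcal H_m: Xf\in\mathcal H_0\}$; - in case (iib), $X_0$ is the unique restriction of $X_{n0}:\mathcal H_0\to\mathcal H_n$ to a self-adjoint operator in $\mathcal H_0$, and its domain is $D(X_0)=\{f\in\mathcal H_0: Xf\in\mathcal H_0\}$. -/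

import Mathlib

/-- A partial inner product space: a complex vector space `V` with a linear compatibility
(a symmetric relation such that the vectors compatible with a given one form a subspace) and a
Hermitian form `⟨f|g⟩`, linear in the second variable, defined exactly on the compatible pairs.
The values of `ip` at incompatible pairs carry no information: no axiom mentions them.
As usual, the form is assumed to be nondegenerate and positive definite. -/
structure PIPSpace (V : Type*) [AddCommGroup V] [Module ℂ V] where
  /-- the compatibility relation `f # g` -/
  compat : V → V → Prop
  compat_symm : ∀ f g, compat f g → compat g f
  compat_zero : ∀ f, compat f 0
  compat_add : ∀ f g h, compat f g → compat f h → compat f (g + h)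
  compat_smul : ∀ f g (c : ℂ), compat f g → compat f (c • g)
  /-- the partial inner product `⟨f|g⟩` -/
  ip : V → V → ℂ
  ip_conj : ∀ f g, compat f g → ip g f = star (ip f g)
  ip_add : ∀ f g h, compat f g → compat f h → ip f (g + h) = ip f g + ip f h
  ip_smul : ∀ f g (c : ℂ), compat f g → ip f (c • g) = c * ip f g
  ip_pos : ∀ f, compat f f → f ≠ 0 → 0 < (ip f f).re
  nondegenerate : ∀ g, (∀ f, (∀ h, compat h f) → ip f g = 0) → g = 0

namespace PIPSpace

variable {V : Type*} [AddCommGroup V] [Module ℂ V]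

/-- `S^#`, the subspace of all vectors compatible with every vector of `S`. -/
def polar (P : PIPSpace V) (S : Submodule ℂ V) : Submodule ℂ V where
  carrier := {g | ∀ f ∈ S, P.compat f g}
  add_mem' := fun ha hb f hf => P.compat_add f _ _ (ha f hf) (hb f hf)
  zero_mem' := fun f _ => P.compat_zero f
  smul_mem' := fun c _ hg f hf => P.compat_smul f _ c (hg f hf)

end PIPSpace

/-- An indexed PIP-space: a generating involutive sublattice `{V_r, r ∈ J}` of the lattice of
assaying subspaces (`S^## = S`) of a PIP-space, where `p ≤ q` means `V_p ⊆ V_q`. -/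
structure IndexedPIPSpace (J : Type*) [Lattice J] (V : Type*) [AddCommGroup V] [Module ℂ V]
    extends PIPSpace V where
  /-- the assaying subspace `V_r` -/
  space : J → Submodule ℂ V
  /-- the involution `r ↦ r̄` -/
  bar : J → J
  assaying : ∀ r, toPIPSpace.polar (toPIPSpace.polar (space r)) = space r
  space_bar : ∀ r, space (bar r) = toPIPSpace.polar (space r)
  space_le : ∀ p q, p ≤ q ↔ space p ≤ space q
  space_inf : ∀ p q, space (p ⊓ q) = space p ⊓ space q
  space_sup : ∀ p q, space (p ⊔ q) = toPIPSpace.polar (toPIPSpace.polar (space p ⊔ space q))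
  generating : ∀ f g, compat f g ↔ ∃ r, f ∈ space r ∧ g ∈ space (bar r)

/-- An indexed PIP-space together with an inner product on each space `V_r`. -/
structure PreLHS (J : Type*) [Lattice J] (V : Type*) [AddCommGroup V] [Module ℂ V]
    extends IndexedPIPSpace J V where
  core : ∀ r, InnerProductSpace.Core ℂ (space r)

namespace PreLHS

variable {J : Type*} [Lattice J] {V : Type*} [AddCommGroup V] [Module ℂ V]

noncomputable instance (L : PreLHS J V) (r : J) : NormedAddCommGroup (L.space r) :=
  (L.core r).toNormedAddCommGroup

noncomputable instance (L : PreLHS J V) (r : J) : InnerProductSpace ℂ (L.space r) :=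
  InnerProductSpace.ofCore (L.core r).toCore

/-- The conditions that make the indexed PIP-space a lattice of Hilbert spaces with central Hilbert
space `V_o`: every `V_r` is a Hilbert space, `V_r̄` with its norm is the conjugate dual of `V_r` under
the partial inner product (so that the norm topology of `V_r` is the Mackey topology `τ(V_r, V_r̄)`),
`V_o` is the unique self-dual space, and on `V_o` the partial inner product is the Hilbert space
inner product. -/
structure IsLHS (L : PreLHS J V) (o : J) : Prop where
  complete : ∀ r, CompleteSpace (L.space r)
  /-- the norm of `V_r̄` is the conjugate (dual) norm of that of `V_r` -/
  dual_norm : ∀ (r : J) (g : L.space (L.bar r)),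
    IsLUB {x : ℝ | ∃ f : L.space r, ‖f‖ ≤ 1 ∧ x = ‖L.ip (g : V) (f : V)‖} ‖g‖
  /-- every continuous functional on `V_r` is given by a vector of `V_r̄` -/
  dual_surj : ∀ (r : J) (φ : L.space r →L[ℂ] ℂ),
    ∃ g : L.space (L.bar r), ∀ f : L.space r, φ f = L.ip (g : V) (f : V)
  bar_o : L.bar o = o
  o_unique : ∀ r, L.bar r = r → r = o
  ip_o : ∀ f g : L.space o, L.ip (f : V) (g : V) = inner ℂ f g

end PreLHS

/-- A lattice of Hilbert spaces (LHS); `o` is the index of its central Hilbert space `V_o`. -/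
structure LHS (J : Type*) [Lattice J] (V : Type*) [AddCommGroup V] [Module ℂ V]
    extends PreLHS J V where
  o : J
  isLHS : toPreLHS.IsLHS o

namespace LHS

variable {J : Type*} [Lattice J] {V : Type*} [AddCommGroup V] [Module ℂ V]

instance (L : LHS J V) (r : J) : CompleteSpace (L.space r) := L.isLHS.complete r

/-- The LHS is a chain of Hilbert spaces: any two of its spaces are comparable. -/
def IsChainOfSpaces (L : LHS J V) : Prop :=
  ∀ p q : J, L.space p ≤ L.space q ∨ L.space q ≤ L.space p

/-- `T` is the representative `A_{pq} : V_q → V_p` of the partially defined map `A` on `V`: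
`V_q` lies in the domain of `A`, and `T` is the restriction of `A` to `V_q`. -/
def IsRep (L : LHS J V) (A : V →. V) {q p : J} (T : L.space q →L[ℂ] L.space p) : Prop :=
  ∀ f : L.space q, (T f : V) ∈ A (f : V)

/-- The domain of `A` is the union of the spaces `V_q` for `q` in a nonempty set of indices, and `A`
maps each of these spaces linearly and continuously into some `V_p`. -/
def IsPreOp (L : LHS J V) (A : V →. V) : Prop :=
  ∃ d : Set J, d.Nonempty ∧ A.Dom = ⋃ q ∈ d, (L.space q : Set V) ∧
    ∀ q ∈ d, ∃ (p : J) (T : L.space q →L[ℂ] L.space p), L.IsRep A T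

/-- `Op(V_J)`: the maps as above that have no proper extension of the same kind. -/
structure Op (L : LHS J V) where
  map : V →. V
  isPreOp : L.IsPreOp map
  maximal : ∀ B : V →. V, L.IsPreOp B → (∀ f y, y ∈ map f → y ∈ B f) → B = map

namespace Op

variable {L : LHS J V}

/-- The set `j(A)` of all pairs `(q, p)` such that `A` maps `V_q` continuously into `V_p`. -/
def j (A : L.Op) : Set (J × J) :=
  {x | ∃ T : L.space x.1 →L[ℂ] L.space x.2, L.IsRep A.map T}

/-- `B` is the adjoint `A^×`: for every representative `A_{pq}` of `A`, the representative
`B_{q̄p̄} : V_p̄ → V_q̄` exists and is the adjoint map of `A_{pq}`, that is,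
`⟨B y|x⟩ = ⟨y|A x⟩` for all `x ∈ V_q`, `y ∈ V_p̄`. -/
def IsAdjoint (A B : L.Op) : Prop :=
  ∀ (q p : J) (T : L.space q →L[ℂ] L.space p), L.IsRep A.map T →
    ∃ S : L.space (L.bar p) →L[ℂ] L.space (L.bar q), L.IsRep B.map S ∧
      ∀ (x : L.space q) (y : L.space (L.bar p)),
        L.ip (S y : V) (x : V) = L.ip (y : V) (T x : V)

/-- `A = A^×`. -/
def IsSymmetric (A : L.Op) : Prop := A.IsAdjoint A

/-- The representative `T = A_{pq}`, `q ≤ p`, is such that `A_{pq} - lam E_{pq} : V_q → V_p` has the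
inverse `R : V_p → V_q`. -/
def IsInverseOfShift {q p : J} (T : L.space q →L[ℂ] L.space p) (lam : ℂ)
    (R : L.space p →L[ℂ] L.space q) : Prop :=
  ∀ (g : L.space p) (f : L.space q), R g = f ↔ (T f : V) - lam • (f : V) = g

end Op

end LHS

/-- The bounded operator `R` is the inverse of `T - z I : D(T) → H`: one has `R g = f` if and only
if `f ∈ D(T)` and `T f - z f = g`. -/
def LinearPMap.IsResolventAt {H : Type*} [NormedAddCommGroup H] [InnerProductSpace ℂ H]
    (T : H →ₗ.[ℂ] H) (z : ℂ) (R : H →L[ℂ] H) : Prop :=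
  ∀ f g : H, R g = f ↔ ∃ h : f ∈ T.domain, T ⟨f, h⟩ - z • f = g

/-- The spectrum of a (possibly unbounded) operator `T` in a Hilbert space: the complement of the
set of all `z` for which `T - z I` has an everywhere defined bounded inverse. -/
def LinearPMap.hilbertSpectrum {H : Type*} [NormedAddCommGroup H] [InnerProductSpace ℂ H]
    (T : H →ₗ.[ℂ] H) : Set ℂ :=
  {z | ¬ ∃ R : H →L[ℂ] H, T.IsResolventAt z R}

namespace LHS

variable {J : Type*} [Lattice J] {V : Type*} [AddCommGroup V] [Module ℂ V]

namespace Op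

variable {L : LHS J V}

/-- `X₀` is the operator in `V_o` determined by the representative `T = X_{nm}` and the number
`lam`: the map `R_{mn} = (X_{nm} - lam E_{nm})⁻¹ : V_n → V_m` is a representative of an operator
`R ∈ Op(V_J)` that has a representative `R_{oo} : V_o → V_o`, and `X₀ - lam I` is the inverse of
`R_{oo}`. -/
def Determines {m n : J} (T : L.space m →L[ℂ] L.space n) (lam : ℂ)
    (X₀ : L.space L.o →ₗ.[ℂ] L.space L.o) : Prop :=
  ∃ (Rmn : L.space n →L[ℂ] L.space m) (R : L.Op) (Roo : L.space L.o →L[ℂ] L.space L.o),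
    IsInverseOfShift T lam Rmn ∧ L.IsRep R.map Rmn ∧ L.IsRep R.map Roo ∧
      X₀.IsResolventAt lam Roo

/-- The representative `X_{pq}` exists, and the operator `T` in `V_o` is a restriction of it. -/
def RestrictsTo (X : L.Op) (q p : J) (T : L.space L.o →ₗ.[ℂ] L.space L.o) : Prop :=
  (q, p) ∈ X.j ∧
    ∀ f : T.domain, ((f : L.space L.o) : V) ∈ L.space q ∧ (T f : V) ∈ X.map ((f : L.space L.o) : V)

/-- `{f ∈ V_q ∩ V_o : X f ∈ V_o}`. -/
def naturalDomain (X : L.Op) (q : J) : Set (L.space L.o) :=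
  {f | (f : V) ∈ L.space q ∧ ∃ y ∈ L.space L.o, y ∈ X.map (f : V)}

/-- `X₀` is obtained from `X_{pq}` by restriction: it is the unique restriction of `X_{pq}` to a
self-adjoint operator in `V_o`, and its domain is obtained by eliminating exactly the vectors that
are mapped by `X_{pq}` beyond `V_o`. -/
def IsObtainedByRestriction (X : L.Op) (q p : J) (X₀ : L.space L.o →ₗ.[ℂ] L.space L.o) : Prop :=
  X.RestrictsTo q p X₀ ∧ IsSelfAdjoint X₀ ∧
    (∀ T : L.space L.o →ₗ.[ℂ] L.space L.o, IsSelfAdjoint T → X.RestrictsTo q p T → T = X₀) ∧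
      (X₀.domain : Set (L.space L.o)) = X.naturalDomain q

end Op

end LHS

/-! ### Symmetrizable operators -/

section HilbertSpace

open Filter Topology

/-! The adjoint `Q : V_m̄ → V_n̄` of `R = (X_nm - λE_nm)⁻¹` inverts the adjoint representative,
shifted by the same `λ` because `λ` is real. Since `X = X^×`, `R` and `Q` are thus inverses of
shifts of one operator, and where their sources and targets are nested one extends the other. In a
chain `n` and `m̄` are comparable, so they are nested; the smaller inverse is then symmetric for the
partial inner product. Locating `o` gives the four cases.

If `o` lies below the source of the smaller inverse, its target lies below `o`, and it restricts to
`V_o` directly. Otherwise its source lies below `o` and contains its target, so it is a symmetric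
operator bounded on a dense subspace with a stronger norm; the Krein–Lax lemma
`norm_apply_le_of_symmetrizable` makes it bounded on `V_o`, and by density this extension is the
restriction of the larger inverse.

The resulting `R_oo` is bounded, symmetric and injective, so `X₀ = R_oo⁻¹ + λI` is self-adjoint
(`IsResolventAt.isSelfAdjoint`). A vector `f` of the domain of the representative with `f`, `Xf` in
`V_o` satisfies `f = R_oo(Xf - λf)`; hence every restriction of the representative to `V_o` lies
below `X₀`, and a self-adjoint one equals it. -/

theorem le_of_forall_pow_le_mul_pow {t s C : ℝ} (hs : 0 ≤ s)
    (h : ∀ k : ℕ, t ^ k ≤ C * s ^ k) : t ≤ s := by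
  by_contra! hst
  have ht' : 0 < t := hs.trans_lt hst
  have h1 : Tendsto (fun k : ℕ => C * (s / t) ^ k) atTop (𝓝 (C * 0)) :=
    (tendsto_pow_atTop_nhds_zero_of_lt_one (by positivity) ((div_lt_one ht').2 hst)).const_mul C
  have h2 : (1 : ℝ) ≤ C * 0 := ge_of_tendsto' h1 fun k => by
    rw [div_pow, ← mul_div_assoc, le_div_iff₀ (by positivity), one_mul]
    exact h k
  linarith

variable {E H : Type*} [NormedAddCommGroup E] [NormedSpace ℂ E]
  [NormedAddCommGroup H] [InnerProductSpace ℂ H]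

/-- The lemma of Krein and Lax: an operator that is bounded on a normed space `E` and symmetric for
the inner product of a Hilbert space into which `E` is continuously mapped is bounded for the norm
of the Hilbert space. -/
theorem norm_apply_le_of_symmetrizable (j : E →L[ℂ] H) (A : E →L[ℂ] E)
    (hA : ∀ x y, inner ℂ (j (A x)) (j y) = inner ℂ (j x) (j (A y))) (x : E) :
    ‖j (A x)‖ ≤ ‖A‖ * ‖j x‖ := by
  have hsq : ∀ y, ‖j (A y)‖ ^ 2 ≤ ‖j y‖ * ‖j (A (A y))‖ := fun y => by
    have h := norm_inner_le_norm (𝕜 := ℂ) (j y) (j (A (A y)))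
    rwa [← hA, inner_self_eq_norm_sq_to_K, norm_pow, RCLike.norm_ofReal, abs_norm] at h
  rcases (norm_nonneg (j x)).eq_or_lt with h0 | h0
  · have h := hsq x
    rw [← h0, zero_mul] at h
    rw [← h0, mul_zero]
    exact (pow_eq_zero_iff two_ne_zero).1 (le_antisymm h (by positivity)) |>.le
  set t := ‖j (A x)‖ / ‖j x‖ with ht
  have ht0 : 0 ≤ t := by positivity
  -- By `hsq` the sequence `‖j (A ^ k x)‖` is log-convex: its growth ratio never falls below the
  -- initial ratio `t`.
  have hstep : ∀ k : ℕ, t * ‖j ((A ^ k) x)‖ ≤ ‖j ((A ^ (k + 1)) x)‖ := by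
    intro k
    induction k with
    | zero => simp [ht, h0.ne']
    | succ k ih =>
      have h := hsq ((A ^ k) x)
      have e : ∀ i : ℕ, A ((A ^ i) x) = (A ^ (i + 1)) x := fun i => by rw [pow_succ']; rfl
      rw [e, e] at h
      rcases (norm_nonneg (j ((A ^ (k + 1)) x))).eq_or_lt with h1 | h1
      · rw [← h1, mul_zero]; positivity
      have h2 : 0 < ‖j ((A ^ k) x)‖ := by
        by_contra! h3
        have h4 : ‖j ((A ^ k) x)‖ = 0 := le_antisymm h3 (norm_nonneg _)
        rw [h4, zero_mul] at h
        nlinarith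
      have h3 : ‖j ((A ^ k) x)‖ * (t * ‖j ((A ^ (k + 1)) x)‖)
          ≤ ‖j ((A ^ k) x)‖ * ‖j ((A ^ (k + 1 + 1)) x)‖ := by
        refine le_trans ?_ h
        have := mul_le_mul_of_nonneg_right ih h1.le
        nlinarith
      exact le_of_mul_le_mul_left h3 h2
  have hpow : ∀ k : ℕ, t ^ k * ‖j x‖ ≤ ‖j ((A ^ k) x)‖ := by
    intro k
    induction k with
    | zero => simp
    | succ k ih =>
      refine le_trans ?_ (hstep k)
      rw [pow_succ', mul_assoc]
      exact mul_le_mul_of_nonneg_left ih ht0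
  -- Geometric growth at rate `t` is compatible with `‖j (A ^ k x)‖ ≤ ‖j‖ ‖A‖ ^ k ‖x‖` for all `k`
  -- only if `t ≤ ‖A‖`.
  have hle : t ≤ ‖A‖ := by
    refine le_of_forall_pow_le_mul_pow (C := ‖j‖ * ‖x‖ / ‖j x‖) (norm_nonneg _) fun k => ?_
    rw [div_mul_eq_mul_div, le_div_iff₀ h0]
    refine (hpow k).trans ((j.le_opNorm _).trans ?_)
    rw [mul_assoc, mul_comm ‖x‖]
    refine mul_le_mul_of_nonneg_left (((A ^ k).le_opNorm x).trans ?_) (norm_nonneg _)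
    refine mul_le_mul_of_nonneg_right ?_ (norm_nonneg _)
    -- Exponent 0 is separate: the identity has norm at most 1, with equality failing on the zero
    -- space.
    rcases k.eq_zero_or_pos with rfl | hk
    · rw [pow_zero, pow_zero]
      exact ContinuousLinearMap.norm_id_le
    · exact norm_pow_le' A hk
  rwa [ht, div_le_iff₀ h0] at hle

/-- The extension to the Hilbert space of a symmetrizable operator. -/
theorem exists_extension_of_symmetrizable [CompleteSpace H] (j : E →L[ℂ] H) (hj : DenseRange j)
    (A : E →L[ℂ] E) (hA : ∀ x y, inner ℂ (j (A x)) (j y) = inner ℂ (j x) (j (A y))) :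
    ∃ B : H →L[ℂ] H, (∀ x, B (j x) = j (A x)) ∧ ∀ x y, inner ℂ (B x) y = inner ℂ x (B y) := by
  have hb : ∃ C, ∀ x, ‖((j.comp A : E →L[ℂ] H) : E →ₗ[ℂ] H) x‖ ≤ C * ‖(j : E →ₗ[ℂ] H) x‖ :=
    ⟨‖A‖, norm_apply_le_of_symmetrizable j A hA⟩
  let B : H →L[ℂ] H := ((j.comp A : E →L[ℂ] H) : E →ₗ[ℂ] H).extendOfNorm (j : E →ₗ[ℂ] H)
  have hB : ∀ x, B (j x) = j (A x) := fun x =>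
    LinearMap.extendOfNorm_eq (e := (j : E →ₗ[ℂ] H)) hj hb x
  refine ⟨B, hB, fun x y => ?_⟩
  refine hj.induction_on₂ (p := fun x y => inner ℂ (B x) y = inner ℂ x (B y)) ?_ ?_ x y
  · exact isClosed_eq (by fun_prop) (by fun_prop)
  · intro a b
    rw [hB, hB, hA]

end HilbertSpace

/-! ### Unbounded operators recovered from a resolvent -/

namespace LinearPMap

variable {H : Type*} [NormedAddCommGroup H] [InnerProductSpace ℂ H]

/-- The operator `R⁻¹ + z I`. -/
noncomputable def ofResolvent (R : H →L[ℂ] H) (hR : Function.Injective R) (z : ℂ) : H →ₗ.[ℂ] H where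
  domain := LinearMap.range (R : H →ₗ[ℂ] H)
  toFun := ((LinearEquiv.ofInjective (R : H →ₗ[ℂ] H) hR).symm : _ →ₗ[ℂ] H)
    + z • (LinearMap.range (R : H →ₗ[ℂ] H)).subtype

theorem isResolventAt_ofResolvent (R : H →L[ℂ] H) (hR : Function.Injective R) (z : ℂ) :
    (ofResolvent R hR z).IsResolventAt z R := by
  intro f g
  have key : ∀ h : f ∈ (ofResolvent R hR z).domain, ofResolvent R hR z ⟨f, h⟩ - z • f
      = (LinearEquiv.ofInjective (R : H →ₗ[ℂ] H) hR).symm ⟨f, h⟩ := fun h => by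
    change ((LinearEquiv.ofInjective (R : H →ₗ[ℂ] H) hR).symm ⟨f, h⟩ + z • f) - z • f = _
    exact add_sub_cancel_right _ _
  constructor
  · rintro rfl
    have h : R g ∈ (ofResolvent R hR z).domain := ⟨g, rfl⟩
    refine ⟨h, (key h).trans ?_⟩
    exact (LinearEquiv.symm_apply_eq _).2 (Subtype.ext rfl)
  · rintro ⟨h, h'⟩
    rw [key h, LinearEquiv.symm_apply_eq] at h'
    exact (congrArg Subtype.val h').symm

namespace IsResolventAt

variable {T S : H →ₗ.[ℂ] H} {z : ℂ} {R : H →L[ℂ] H}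

theorem le (hT : T.IsResolventAt z R) (hS : S.IsResolventAt z R) : T ≤ S := by
  have h : ∀ f (hf : f ∈ T.domain), ∃ hf' : f ∈ S.domain, S ⟨f, hf'⟩ = T ⟨f, hf⟩ := fun f hf => by
    obtain ⟨hf', e⟩ := (hS f _).1 ((hT f _).2 ⟨hf, rfl⟩)
    exact ⟨hf', sub_left_injective e⟩
  refine ⟨fun f hf => (h f hf).1, ?_⟩
  rintro ⟨f, hf⟩ ⟨g, hg⟩ (rfl : f = g)
  exact (h f hf).2.symm

theorem unique (hT : T.IsResolventAt z R) (hS : S.IsResolventAt z R) : T = S :=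
  le_antisymm (hT.le hS) (hS.le hT)

theorem mem_domain (hT : T.IsResolventAt z R) (g : H) : R g ∈ T.domain :=
  ((hT _ g).1 rfl).1

theorem apply (hT : T.IsResolventAt z R) (g : H) :
    T ⟨R g, hT.mem_domain g⟩ = g + z • R g :=
  sub_eq_iff_eq_add.1 ((hT _ g).1 rfl).2

theorem resolvent_apply (hT : T.IsResolventAt z R) (f : T.domain) :
    R (T f - z • (f : H)) = f :=
  (hT _ _).2 ⟨f.2, rfl⟩

theorem injective (hT : T.IsResolventAt z R) : Function.Injective R := by
  intro g h e
  have h1 := ((hT _ g).1 rfl).2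
  obtain ⟨_, h2⟩ := (hT (R g) h).1 e.symm
  exact h1.symm.trans h2

variable [CompleteSpace H]

/-- If `x` is orthogonal to the range of `R`, then `⟨Rx, Rx⟩ = ⟨R(Rx), x⟩ = 0`, and `R` is
injective. -/
theorem dense_domain (hT : T.IsResolventAt z R)
    (hR : ∀ x y, inner ℂ (R x) y = inner ℂ x (R y)) : Dense (T.domain : Set H) := by
  rw [Submodule.dense_iff_topologicalClosure_eq_top, Submodule.topologicalClosure_eq_top_iff,
    Submodule.eq_bot_iff]
  intro x hx
  have h : R x = 0 := by
    have := (Submodule.mem_orthogonal _ _).1 hx _ (hT.mem_domain (R x))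
    rwa [hR, inner_self_eq_zero] at this
  exact hT.injective (h.trans (_root_.map_zero R).symm)

theorem isSelfAdjoint {lam : ℝ} (hT : T.IsResolventAt lam R)
    (hR : ∀ x y, inner ℂ (R x) y = inner ℂ x (R y)) : IsSelfAdjoint T := by
  have hd := hT.dense_domain hR
  have hform : T.IsFormalAdjoint T := by
    intro x y
    obtain ⟨g, hg⟩ : ∃ g, R g = x := ⟨_, hT.resolvent_apply x⟩
    obtain ⟨k, hk⟩ : ∃ k, R k = y := ⟨_, hT.resolvent_apply y⟩
    obtain rfl : x = ⟨R g, hT.mem_domain g⟩ := Subtype.ext hg.symm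
    obtain rfl : y = ⟨R k, hT.mem_domain k⟩ := Subtype.ext hk.symm
    rw [hT.apply, hT.apply]
    simp only [inner_add_left, inner_add_right, inner_smul_left, inner_smul_right, hR,
      Complex.conj_ofReal, _root_.map_add, _root_.map_smul]
  have hle := hform.le_adjoint hd
  rw [isSelfAdjoint_def]
  refine (eq_of_le_of_domain_eq hle (le_antisymm hle.1 fun y hy => ?_)).symm
  -- Symmetry is already known; this puts each `y` of the adjoint's domain in the range of `R`,
  -- which is the domain of `T`.
  have h : y = R (T.adjoint ⟨y, hy⟩ - (lam : ℂ) • y) := by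
    refine ext_inner_right ℂ fun g => ?_
    have h1 := adjoint_isFormalAdjoint hd ⟨y, hy⟩ ⟨R g, hT.mem_domain g⟩
    rw [hT.apply, inner_add_right, inner_smul_right] at h1
    rw [hR, inner_sub_left, inner_smul_left, Complex.conj_ofReal, h1]
    simp
  rw [h]
  exact hT.mem_domain _

end IsResolventAt

/-- Adjoints reverse inclusion: `T = T* ≤ S* = S`. -/
theorem eq_of_isSelfAdjoint_of_le {H : Type*} [NormedAddCommGroup H] [InnerProductSpace ℂ H]
    [CompleteSpace H] {S T : H →ₗ.[ℂ] H} (hS : IsSelfAdjoint S) (hT : IsSelfAdjoint T)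
    (h : S ≤ T) : S = T := by
  refine le_antisymm h ?_
  have hform : S.IsFormalAdjoint T := by
    intro x y
    have h1 := adjoint_isFormalAdjoint hT.dense_domain
    rw [isSelfAdjoint_def.1 hT] at h1
    have h2 := h1 ⟨x, h.1 x.2⟩ y
    rwa [← h.2 (x := x) (y := ⟨x, h.1 x.2⟩) rfl] at h2
  have := hform.le_adjoint hS.dense_domain
  rwa [isSelfAdjoint_def.1 hS] at this

end LinearPMap

/-! ### Duality, inclusions and extension to maximal operators -/

namespace LHS

open Filter Topology

variable {J : Type*} [Lattice J] {V : Type*} [AddCommGroup V] [Module ℂ V] (L : LHS J V)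

section Duality

variable {r : J}

theorem compat_of_mem {f g : V} (hg : g ∈ L.space (L.bar r)) (hf : f ∈ L.space r) :
    L.compat g f := by
  rw [L.space_bar] at hg
  exact L.compat_symm _ _ (hg f hf)

theorem space_bar_bar (r : J) : L.space (L.bar (L.bar r)) = L.space r := by
  rw [L.space_bar, L.space_bar, L.assaying]

theorem bar_le_bar {p q : J} (h : p ≤ q) : L.bar q ≤ L.bar p := by
  rw [L.space_le, L.space_bar, L.space_bar]
  exact fun g hg f hf => hg f ((L.space_le p q).1 h hf)

/-- The test vectors of `nondegenerate` thus lie in every space, so pairing with any single `V_r`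
suffices to apply it. -/
theorem mem_space_of_forall_compat {f : V} (hf : ∀ h, L.compat h f) (r : J) : f ∈ L.space r := by
  rw [← L.assaying]
  exact fun h _ => hf h

theorem ip_sub {f g h : V} (hg : L.compat f g) (hh : L.compat f h) :
    L.ip f (g - h) = L.ip f g - L.ip f h := by
  have e : g - h = g + (-1 : ℂ) • h := by rw [neg_one_smul, sub_eq_add_neg]
  rw [e, L.ip_add _ _ _ hg (L.compat_smul _ _ _ hh), L.ip_smul _ _ _ hh]
  ring

theorem ip_add_left {f g h : V} (hg : L.compat g f) (hh : L.compat h f) :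
    L.ip (g + h) f = L.ip g f + L.ip h f := by
  have hg' := L.compat_symm _ _ hg
  have hh' := L.compat_symm _ _ hh
  rw [L.ip_conj f (g + h) (L.compat_add _ _ _ hg' hh'), L.ip_add _ _ _ hg' hh', star_add,
    ← L.ip_conj _ _ hg', ← L.ip_conj _ _ hh']

theorem ip_smul_left {f g : V} (c : ℂ) (hg : L.compat g f) :
    L.ip (c • g) f = star c * L.ip g f := by
  have hg' := L.compat_symm _ _ hg
  rw [L.ip_conj f (c • g) (L.compat_smul _ _ _ hg'), L.ip_smul _ _ _ hg', star_mul',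
    ← L.ip_conj _ _ hg']

theorem ip_sub_left {f g h : V} (hg : L.compat g f) (hh : L.compat h f) :
    L.ip (g - h) f = L.ip g f - L.ip h f := by
  have hg' := L.compat_symm _ _ hg
  have hh' := L.compat_symm _ _ hh
  have e : L.compat f (g - h) := by
    rw [sub_eq_add_neg, ← neg_one_smul ℂ h]
    exact L.compat_add _ _ _ hg' (L.compat_smul _ _ _ hh')
  rw [L.ip_conj f (g - h) e, L.ip_sub hg' hh', star_sub,
    ← L.ip_conj _ _ hg', ← L.ip_conj _ _ hh']

theorem eq_of_ip_right {f h : L.space r}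
    (H : ∀ g : L.space (L.bar r), L.ip (g : V) (f : V) = L.ip (g : V) (h : V)) : f = h := by
  refine Subtype.ext (sub_eq_zero.1 (L.nondegenerate _ fun u hu => ?_))
  have hu' := L.mem_space_of_forall_compat hu (L.bar r)
  rw [L.ip_sub (L.compat_of_mem hu' f.2) (L.compat_of_mem hu' h.2), sub_eq_zero]
  exact H ⟨u, hu'⟩

theorem eq_of_ip_left {g h : L.space (L.bar r)}
    (H : ∀ f : L.space r, L.ip (g : V) (f : V) = L.ip (h : V) (f : V)) : g = h := by
  refine L.eq_of_ip_right fun f => ?_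
  have hf : (f : V) ∈ L.space r := L.space_bar_bar r ▸ f.2
  rw [L.ip_conj _ _ (L.compat_of_mem g.2 hf), L.ip_conj _ _ (L.compat_of_mem h.2 hf)]
  exact congrArg star (H ⟨f, hf⟩)

theorem norm_ip_le (g : L.space (L.bar r)) (f : L.space r) :
    ‖L.ip (g : V) (f : V)‖ ≤ ‖g‖ * ‖f‖ := by
  rcases eq_or_ne f 0 with rfl | hf
  · have := L.ip_smul (g : V) 0 0 (L.compat_zero _)
    rw [zero_smul, zero_mul] at this
    simp [this]
  have hf' : 0 < ‖f‖ := norm_pos_iff.2 hf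
  have h := (L.isLHS.dual_norm r g).1 ⟨((‖f‖⁻¹ : ℝ) : ℂ) • f, by
    rw [norm_smul, Complex.norm_real, norm_inv, norm_norm, inv_mul_cancel₀ hf'.ne'], rfl⟩
  rw [Submodule.coe_smul, L.ip_smul _ _ _ (L.compat_of_mem g.2 f.2), norm_mul, Complex.norm_real,
    norm_inv, norm_norm, inv_mul_le_iff₀ hf'] at h
  linarith

/-- The functional `⟨g|·⟩` on `V_r`, for `g ∈ V_r̄`. -/
noncomputable def functional (g : L.space (L.bar r)) : L.space r →L[ℂ] ℂ :=
  LinearMap.mkContinuous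
    { toFun := fun f => L.ip (g : V) (f : V)
      map_add' := fun f h => L.ip_add _ _ _ (L.compat_of_mem g.2 f.2) (L.compat_of_mem g.2 h.2)
      map_smul' := fun c f => L.ip_smul _ _ c (L.compat_of_mem g.2 f.2) } ‖g‖ (L.norm_ip_le g)

end Duality

/-- Every continuous map `V_q → V_p` has an adjoint `V_p̄ → V_q̄`. -/
theorem exists_adjoint {q p : J} (T : L.space q →L[ℂ] L.space p) :
    ∃ S : L.space (L.bar p) →L[ℂ] L.space (L.bar q),
      ∀ (x : L.space q) (y : L.space (L.bar p)),
        L.ip (S y : V) (x : V) = L.ip (y : V) (T x : V) := by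
  choose S hS using fun y : L.space (L.bar p) => L.isLHS.dual_surj q ((L.functional y).comp T)
  replace hS : ∀ (y : L.space (L.bar p)) (x : L.space q),
    L.ip (S y : V) (x : V) = L.ip (y : V) (T x : V) := fun y x => (hS y x).symm
  let S' : L.space (L.bar p) →ₗ[ℂ] L.space (L.bar q) :=
    { toFun := S
      map_add' := fun y z => L.eq_of_ip_left fun x => by
        rw [Submodule.coe_add, L.ip_add_left (L.compat_of_mem (S y).2 x.2)
          (L.compat_of_mem (S z).2 x.2), hS, hS, hS, Submodule.coe_add,
          L.ip_add_left (L.compat_of_mem y.2 (T x).2) (L.compat_of_mem z.2 (T x).2)]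
      map_smul' := fun c y => L.eq_of_ip_left fun x => by
        rw [RingHom.id_apply, Submodule.coe_smul, L.ip_smul_left c (L.compat_of_mem (S y).2 x.2),
          hS, hS, Submodule.coe_smul, L.ip_smul_left c (L.compat_of_mem y.2 (T x).2)] }
  refine ⟨S'.mkContinuous ‖T‖ fun y => ?_, fun x y => hS y x⟩
  refine (isLUB_le_iff (L.isLHS.dual_norm q (S y))).2 ?_
  rintro _ ⟨f, hf, rfl⟩
  rw [hS]
  calc ‖L.ip (y : V) (T f : V)‖ ≤ ‖y‖ * ‖T f‖ := L.norm_ip_le y (T f)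
    _ ≤ ‖y‖ * (‖T‖ * 1) := by
        gcongr
        exact (T.le_opNorm f).trans (by gcongr)
    _ = ‖T‖ * ‖y‖ := by ring

section Inclusion

variable {p q : J}

/-- Closed graph theorem: limits in `V_p` and in `V_q` have the same pairings with `V_q̄ ⊆ V_p̄`. -/
theorem continuous_inclusion (h : L.space p ≤ L.space q) :
    Continuous (Submodule.inclusion h) := by
  refine LinearMap.continuous_of_seq_closed_graph _ fun u x y hu hy => ?_
  refine L.eq_of_ip_right fun g => ?_
  have hg : (g : V) ∈ L.space (L.bar p) :=
    (L.space_le _ _).1 (L.bar_le_bar ((L.space_le _ _).2 h)) g.2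
  have h1 := ((L.functional g).continuous.tendsto y).comp hy
  have h2 := ((L.functional (r := p) ⟨g, hg⟩).continuous.tendsto x).comp hu
  exact tendsto_nhds_unique h1 h2

/-- The inclusion `E_{qp} : V_p → V_q`. -/
noncomputable def incl (h : p ≤ q) : L.space p →L[ℂ] L.space q :=
  ⟨Submodule.inclusion ((L.space_le _ _).1 h), L.continuous_inclusion _⟩

@[simp]
theorem coe_incl (h : p ≤ q) (f : L.space p) : (L.incl h f : V) = f := rfl

theorem denseRange_incl (h : p ≤ L.o) : DenseRange (L.incl h) := by
  have : Dense ((LinearMap.range (L.incl h : L.space p →ₗ[ℂ] L.space L.o)) :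
      Set (L.space L.o)) := by
    rw [Submodule.dense_iff_topologicalClosure_eq_top, Submodule.topologicalClosure_eq_top_iff,
      Submodule.eq_bot_iff]
    intro x hx
    refine Subtype.ext (L.nondegenerate _ fun u hu => ?_)
    have hu' := L.mem_space_of_forall_compat hu p
    have := (Submodule.mem_orthogonal _ _).1 hx (L.incl h ⟨u, hu'⟩) ⟨_, rfl⟩
    rwa [← L.isLHS.ip_o] at this
  simpa [DenseRange] using! this

end Inclusion

/-- A symmetric operator in `V_a`, `a ≤ o`, that has an extension to a continuous map from `V_o` to
some larger space, leaves `V_o` invariant and is bounded there. -/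
theorem exists_bounded_on_center {a r : J} (ha : a ≤ L.o) (hr : L.o ≤ r)
    (A : L.space a →L[ℂ] L.space a) (B : L.space L.o →L[ℂ] L.space r)
    (hAB : ∀ f : L.space a, (B (L.incl ha f) : V) = A f)
    (hA : ∀ f g : L.space a, L.ip (A f : V) (g : V) = L.ip (f : V) (A g : V)) :
    ∃ R : L.space L.o →L[ℂ] L.space L.o, (∀ g, (R g : V) = B g) ∧
      ∀ f g, inner ℂ (R f) g = inner ℂ f (R g) := by
  obtain ⟨R, hRA, hR⟩ := exists_extension_of_symmetrizable (L.incl ha) (L.denseRange_incl ha) A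
    fun f g => by rw [← L.isLHS.ip_o, ← L.isLHS.ip_o]; exact hA f g
  have h : ⇑((L.incl hr).comp R) = B := by
    refine (L.denseRange_incl ha).equalizer (by fun_prop) (by fun_prop) (funext fun f => ?_)
    refine Subtype.ext ?_
    simp [hRA, hAB]
  exact ⟨R, fun g => by rw [← congrFun h g]; rfl, hR⟩

theorem IsRep.eq_of_mem {L : LHS J V} {A : V →. V} {q p : J} {T : L.space q →L[ℂ] L.space p}
    (hT : L.IsRep A T) {f : V} (hf : f ∈ L.space q) {y : V} (hy : y ∈ A f) : y = T ⟨f, hf⟩ :=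
  Part.mem_unique hy (hT ⟨f, hf⟩)

/-- Every continuous map `V_q → V_p` is a representative of an operator. -/
theorem exists_op_isRep {q p : J} (T : L.space q →L[ℂ] L.space p) :
    ∃ A : L.Op, L.IsRep A.map T := by
  let A₀ : V → Part V := fun f => ⟨f ∈ L.space q, fun h => (T ⟨f, h⟩ : V)⟩
  have hA₀ : L.IsRep A₀ T := fun f => ⟨f.2, rfl⟩
  have hpre : L.IsPreOp A₀ :=
    ⟨{q}, Set.singleton_nonempty q,
      by simp only [Set.mem_singleton_iff, Set.iUnion_iUnion_eq_left]; rfl,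
      by rintro _ rfl; exact ⟨p, T, hA₀⟩⟩
  -- Zorn's lemma for the extension order; the union `U` of the graphs in a chain is single-valued
  -- and is an upper bound.
  obtain ⟨M, hM, hmax⟩ := zorn_le_nonempty₀ {B : V → Part V | L.IsPreOp B}
    (fun c hc hchain y hy => by
      have huniq : ∀ B ∈ c, ∀ B' ∈ c, ∀ f u v, u ∈ B f → v ∈ B' f → u = v := by
        intro B hB B' hB' f u v hu hv
        rcases hchain.total hB hB' with h | h
        · exact Part.mem_unique (h f u hu) hv
        · exact Part.mem_unique hu (h f v hv)
      let U : V → Part V := fun f => ⟨∃ u, ∃ B ∈ c, u ∈ B f, fun h => h.choose⟩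
      have hU : ∀ f u, u ∈ U f ↔ ∃ B ∈ c, u ∈ B f := by
        intro f u
        constructor
        · rintro ⟨h, rfl⟩
          exact h.choose_spec
        · rintro ⟨B, hB, hu⟩
          have h : ∃ u, ∃ B ∈ c, u ∈ B f := ⟨u, B, hB, hu⟩
          obtain ⟨B', hB', hu'⟩ := h.choose_spec
          exact ⟨h, huniq B' hB' B hB f _ _ hu' hu⟩
      refine ⟨U, ?_, fun B hB f u hu => (hU f u).2 ⟨B, hB, hu⟩⟩
      refine ⟨{s | ∃ (t : J) (S : L.space s →L[ℂ] L.space t), L.IsRep U S}, ?_, ?_, fun s hs => hs⟩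
      · obtain ⟨d, ⟨s, hs⟩, -, hd⟩ := hc hy
        obtain ⟨t, S, hS⟩ := hd s hs
        exact ⟨s, t, S, fun f => (hU _ _).2 ⟨y, hy, hS f⟩⟩
      · ext f
        refine (PFun.mem_dom (U : V →. V) f).trans ?_
        rw [Set.mem_iUnion₂]
        constructor
        · rintro ⟨u, hu⟩
          obtain ⟨B, hB, hu⟩ := (hU f u).1 hu
          obtain ⟨d, -, hdom, hd⟩ := hc hB
          have hf : f ∈ PFun.Dom B := (PFun.mem_dom B f).2 ⟨u, hu⟩
          rw [hdom, Set.mem_iUnion₂] at hf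
          obtain ⟨s, hs, hf⟩ := hf
          obtain ⟨t, S, hS⟩ := hd s hs
          exact ⟨s, ⟨t, S, fun f => (hU _ _).2 ⟨B, hB, hS f⟩⟩, hf⟩
        · rintro ⟨s, ⟨t, S, hS⟩, hf⟩
          exact ⟨_, hS ⟨f, hf⟩⟩) A₀ hpre
  refine ⟨⟨M, hmax.1, fun B hB h => ?_⟩, fun f => hM _ _ (hA₀ f)⟩
  have h' : (M : V → Part V) ≤ B := h
  exact le_antisymm (α := V → Part V) (hmax.2 hB h') h'

end LHS

/-! ### Inverses of shifted representatives -/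

namespace LHS

variable {J : Type*} [Lattice J] {V : Type*} [AddCommGroup V] [Module ℂ V]

theorem IsChainOfSpaces.le_total {L : LHS J V} (h : L.IsChainOfSpaces) (p q : J) :
    p ≤ q ∨ q ≤ p := by
  rw [L.space_le, L.space_le]
  exact h p q

theorem le_bar_of_le_center (L : LHS J V) {r : J} (h : r ≤ L.o) : L.o ≤ L.bar r :=
  L.isLHS.bar_o ▸ L.bar_le_bar h

theorem bar_le_of_center_le (L : LHS J V) {r : J} (h : L.o ≤ r) : L.bar r ≤ L.o := by
  have := L.bar_le_bar h
  rwa [L.isLHS.bar_o] at this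

theorem le_of_bar_le_bar (L : LHS J V) {p q : J} (h : L.bar q ≤ L.bar p) : p ≤ q := by
  have := (L.space_le _ _).1 (L.bar_le_bar h)
  rwa [L.space_bar_bar, L.space_bar_bar, ← L.space_le] at this

namespace Op

variable {L : LHS J V} {q p : J}

theorem exists_isInverseOfShift (h : L.space q ≤ L.space p) (T : L.space q →L[ℂ] L.space p)
    (lam : ℂ) (hbij : Function.Bijective fun f : L.space q => T f - lam • Submodule.inclusion h f) :
    ∃ R : L.space p →L[ℂ] L.space q, IsInverseOfShift T lam R := by
  let D : L.space q →L[ℂ] L.space p := T - lam • L.incl ((L.space_le _ _).2 h)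
  let e := ContinuousLinearEquiv.ofBijective D (LinearMap.ker_eq_bot.2 hbij.1)
    (LinearMap.range_eq_top.2 hbij.2)
  refine ⟨e.symm, fun g f => ?_⟩
  change e.symm g = f ↔ _
  rw [ContinuousLinearEquiv.symm_apply_eq, eq_comm, Subtype.ext_iff]
  rfl

namespace IsInverseOfShift

variable {T : L.space q →L[ℂ] L.space p} {R : L.space p →L[ℂ] L.space q} {lam : ℂ}

theorem apply_inverse (h : IsInverseOfShift T lam R) (g : L.space p) :
    (T (R g) : V) - lam • (R g : V) = g :=
  (h g _).1 rfl

theorem inverse_apply (h : IsInverseOfShift T lam R) {f : L.space q} {g : L.space p}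
    (e : (T f : V) - lam • (f : V) = g) : R g = f :=
  (h g f).2 e

theorem unique {R' : L.space p →L[ℂ] L.space q} (h : IsInverseOfShift T lam R)
    (h' : IsInverseOfShift T lam R') : R = R' :=
  ContinuousLinearMap.ext fun g => h.inverse_apply (h'.apply_inverse g)

theorem injective (h : IsInverseOfShift T lam R) : Function.Injective R := fun f g e =>
  Subtype.ext <| by rw [← h.apply_inverse f, e, h.apply_inverse]

/-- The inverses of the shifts of two representatives of the same operator agree. -/
theorem eq_of_le {X : L.Op} (hT : L.IsRep X.map T) (h : IsInverseOfShift T lam R)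
    {q' p' : J} {T' : L.space q' →L[ℂ] L.space p'} {R' : L.space p' →L[ℂ] L.space q'}
    (hT' : L.IsRep X.map T') (h' : IsInverseOfShift T' lam R') (hq : q ≤ q') (hp : p ≤ p')
    (g : L.space p) : (R' (L.incl hp g) : V) = R g := by
  have e : (T' (L.incl hq (R g)) : V) = T (R g) := Part.mem_unique (hT' _) (hT _)
  rw [h'.inverse_apply (f := L.incl hq (R g)), L.coe_incl]
  rw [e, L.coe_incl, h.apply_inverse, L.coe_incl]

/-- The adjoint of the inverse is the inverse of the adjoint. -/
theorem adjoint {lam : ℝ} (h : IsInverseOfShift T lam R) (hqp : q ≤ p)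
    {S : L.space (L.bar p) →L[ℂ] L.space (L.bar q)}
    (hS : ∀ (x : L.space q) (y : L.space (L.bar p)), L.ip (S y : V) (x : V) = L.ip (y : V) (T x : V))
    {Q : L.space (L.bar q) →L[ℂ] L.space (L.bar p)}
    (hQ : ∀ (x : L.space p) (y : L.space (L.bar q)),
      L.ip (Q y : V) (x : V) = L.ip (y : V) (R x : V)) :
    IsInverseOfShift S lam Q := by
  -- The pairing `⟨f|x⟩` makes sense because `V_q ⊆ V_p`; real `lam` passes through the conjugation.
  have key : ∀ (f : L.space (L.bar p)) (x : L.space q),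
      L.ip ((S f : V) - (lam : ℂ) • (f : V)) (x : V) = L.ip (f : V) ((T x : V) - (lam : ℂ) • (x : V)) := by
    intro f x
    have hfx := L.compat_of_mem f.2 (L.incl hqp x).2
    have hfx' : L.compat ((lam : ℂ) • (f : V)) (x : V) :=
      L.compat_of_mem ((lam : ℂ) • f).2 (L.incl hqp x).2
    rw [L.coe_incl] at hfx
    rw [L.ip_sub_left (L.compat_of_mem (S f).2 x.2) hfx', L.ip_smul_left _ hfx,
      L.ip_sub (L.compat_of_mem f.2 (T x).2) (L.compat_smul _ _ _ hfx), L.ip_smul _ _ _ hfx, hS]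
    simp
  intro g f
  constructor
  · rintro rfl
    have : S (Q g) - (lam : ℂ) • L.incl (L.bar_le_bar hqp) (Q g) = g :=
      L.eq_of_ip_left fun x => by
        refine (key _ x).trans ?_
        have hx : (T x : V) - (lam : ℂ) • (x : V) = (T x - (lam : ℂ) • L.incl hqp x : L.space p) := rfl
        rw [hx, hQ, h.inverse_apply hx]
    exact congrArg Subtype.val this
  · intro e
    refine L.eq_of_ip_left fun x => ?_
    rw [hQ, ← e, key, h.apply_inverse]

/-- The smaller of the two resolvents `R₁ : V_p → V_q`, `R₂ : V_p' → V_q'` being symmetric, the larger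
one has a symmetric bounded restriction to the central Hilbert space. -/
theorem exists_center_restriction {X : L.Op} (hT : L.IsRep X.map T) (h : IsInverseOfShift T lam R)
    {q' p' : J} {T' : L.space q' →L[ℂ] L.space p'} {R' : L.space p' →L[ℂ] L.space q'}
    (hT' : L.IsRep X.map T') (h' : IsInverseOfShift T' lam R') (hq : q ≤ q') (hp : p ≤ p')
    (hqp : q ≤ p) (ho : L.o ≤ p') (hcase : p ≤ L.o ∧ L.o ≤ q' ∨ L.o ≤ p ∧ q ≤ L.o)
    (hsymm : ∀ f g : L.space p, L.ip (R f : V) (g : V) = L.ip (f : V) (R g : V)) :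
    ∃ Roo : L.space L.o →L[ℂ] L.space L.o, (∀ f g, inner ℂ (Roo f) g = inner ℂ f (Roo g)) ∧
      (∀ g, (Roo g : V) = R' (L.incl ho g)) ∧
      (∀ (g : L.space L.o) (hg : (g : V) ∈ L.space p), (Roo g : V) = R ⟨g, hg⟩) ∧
      ∃ A : L.Op, L.IsRep A.map R ∧ L.IsRep A.map R' ∧ L.IsRep A.map Roo := by
  suffices H : ∃ Roo : L.space L.o →L[ℂ] L.space L.o,
      (∀ f g, inner ℂ (Roo f) g = inner ℂ f (Roo g)) ∧ ∀ g, (Roo g : V) = R' (L.incl ho g) by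
    obtain ⟨Roo, h1, h2⟩ := H
    -- Both `R` and `Roo` are restrictions of `R'`, so any operator extending `R'` has all three as
    -- representatives.
    obtain ⟨A, hA⟩ := L.exists_op_isRep R'
    refine ⟨Roo, h1, h2, fun g hg => ?_, A, fun g => ?_, hA, fun g => ?_⟩
    · rw [h2]
      exact eq_of_le hT h hT' h' hq hp ⟨g, hg⟩
    · rw [← eq_of_le hT h hT' h' hq hp g]
      exact hA (L.incl hp g)
    · rw [h2]
      exact hA (L.incl ho g)
  rcases hcase with ⟨hpo, hoq⟩ | ⟨hop, hqo⟩
  · obtain ⟨Roo, h1, h2⟩ := L.exists_bounded_on_center hpo hoq ((L.incl hqp).comp R)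
      (R'.comp (L.incl ho)) (eq_of_le hT h hT' h' hq hp) hsymm
    exact ⟨Roo, h2, h1⟩
  · refine ⟨(L.incl hqo).comp (R.comp (L.incl hop)), fun f g => ?_, fun g => ?_⟩
    · rw [← L.isLHS.ip_o, ← L.isLHS.ip_o]
      exact hsymm (L.incl hop f) (L.incl hop g)
    · exact (eq_of_le hT h hT' h' hq hp (L.incl hop g)).symm

/-- The operator in the central Hilbert space whose resolvent is a restriction of the inverse of the
shift of a representative is obtained by restriction of this representative. -/
theorem isObtainedByRestriction {X : L.Op} {lam : ℝ} (hT : L.IsRep X.map T)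
    (h : IsInverseOfShift T lam R) (hop : L.o ≤ p) {Roo : L.space L.o →L[ℂ] L.space L.o}
    (hsymm : ∀ f g, inner ℂ (Roo f) g = inner ℂ f (Roo g))
    (hRoo : ∀ g, (Roo g : V) = R (L.incl hop g)) {X₀ : L.space L.o →ₗ.[ℂ] L.space L.o}
    (hX₀ : X₀.IsResolventAt lam Roo) {r : J} (hr : r ≤ q)
    (hmem : ∀ f ∈ L.space L.o, f ∈ L.space q → f ∈ L.space r) :
    X.IsObtainedByRestriction r p X₀ := by
  have h1 : ∀ f : X₀.domain, ((f : L.space L.o) : V) ∈ L.space q ∧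
      (X₀ f : V) ∈ X.map ((f : L.space L.o) : V) := by
    intro f
    have e := hX₀.resolvent_apply f
    have e' := (hRoo _).symm.trans (congrArg Subtype.val e)
    have hf : ((f : L.space L.o) : V) ∈ L.space q := e' ▸ Subtype.prop _
    refine ⟨hf, ?_⟩
    have hTf := h.apply_inverse (L.incl hop (X₀ f - (lam : ℂ) • (f : L.space L.o)))
    rw [show R (L.incl hop (X₀ f - (lam : ℂ) • (f : L.space L.o))) = ⟨_, hf⟩ from Subtype.ext e',
      L.coe_incl, Submodule.coe_sub, Submodule.coe_smul] at hTf
    rw [← sub_left_injective hTf]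
    exact hT ⟨_, hf⟩
  have h2 : ∀ f y : L.space L.o, (f : V) ∈ L.space q → (y : V) ∈ X.map (f : V) →
      ∃ hf : f ∈ X₀.domain, X₀ ⟨f, hf⟩ = y := by
    intro f y hf hy
    have e : R (L.incl hop (y - (lam : ℂ) • f)) = ⟨f, hf⟩ := h.inverse_apply <| by
      rw [← hT.eq_of_mem hf hy]
      rfl
    have e' : Roo (y - (lam : ℂ) • f) = f := Subtype.ext <| by rw [hRoo, e]
    obtain ⟨hf', e''⟩ := (hX₀ _ _).1 e'
    exact ⟨hf', sub_left_injective e''⟩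
  -- Only `V_q ∩ V_o` matters, so `q` may be replaced by `r` with the same intersection; `r = o`
  -- serves cases (ia) and (iib).
  have hrq := (L.space_le _ _).1 hr
  refine ⟨⟨⟨T.comp (L.incl hr), fun f => hT (L.incl hr f)⟩,
    fun f => ⟨hmem _ f.1.2 (h1 f).1, (h1 f).2⟩⟩, hX₀.isSelfAdjoint hsymm, fun S hS hSX => ?_, ?_⟩
  · refine LinearPMap.eq_of_isSelfAdjoint_of_le hS (hX₀.isSelfAdjoint hsymm) ⟨fun f hf => ?_, ?_⟩
    · obtain ⟨ha, hb⟩ := hSX.2 ⟨f, hf⟩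
      exact (h2 f _ (hrq ha) hb).1
    · rintro ⟨f, hf⟩ ⟨g, hg⟩ (rfl : f = g)
      obtain ⟨ha, hb⟩ := hSX.2 ⟨f, hf⟩
      exact (h2 f _ (hrq ha) hb).2.symm
  · ext f
    constructor
    · intro hf
      exact ⟨hmem _ f.2 (h1 ⟨f, hf⟩).1, _, (X₀ ⟨f, hf⟩).2, (h1 ⟨f, hf⟩).2⟩
    · rintro ⟨hf, y, hy, hXf⟩
      exact (h2 f ⟨y, hy⟩ (hrq hf) hXf).1

end IsInverseOfShift

/-- `X_{nm}` determines at most one operator in the central Hilbert space. -/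
theorem Determines.unique (hchain : L.IsChainOfSpaces) {T : L.space q →L[ℂ] L.space p} {lam : ℂ}
    {X₀ Y₀ : L.space L.o →ₗ.[ℂ] L.space L.o} (hX : Determines T lam X₀)
    (hY : Determines T lam Y₀) : X₀ = Y₀ := by
  obtain ⟨R, A, Roo, hR, hAR, hAo, hX₀⟩ := hX
  obtain ⟨R', B, Qoo, hR', hBR, hBo, hY₀⟩ := hY
  obtain rfl := hR.unique hR'
  -- The maximal operators `A` and `B` may differ, but both continue the same `R`; `V_p ∩ V_o` is
  -- either dense in `V_o` or all of it.
  have key : ∀ g : L.space L.o, (g : V) ∈ L.space p → Roo g = Qoo g := fun g hg =>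
    Subtype.ext <| (hAR.eq_of_mem hg (hAo g)).trans (hBR.eq_of_mem hg (hBo g)).symm
  suffices e : Roo = Qoo by
    subst e
    exact hX₀.unique hY₀
  rcases hchain.le_total p L.o with h | h
  · refine DFunLike.coe_injective <| (L.denseRange_incl h).equalizer Roo.continuous Qoo.continuous ?_
    exact funext fun f => key _ f.2
  · exact ContinuousLinearMap.ext fun g => key g ((L.space_le _ _).1 h g.2)

end Op

end LHS

/-! ### The corollary -/

theorem corollary3p3 {J : Type*} [Lattice J] {V : Type*} [AddCommGroup V] [Module ℂ V]
    (L : LHS J V) (hchain : L.IsChainOfSpaces)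
    (X : L.Op) (hX : X.IsSymmetric) (m n : J) (hmn : L.space m ≤ L.space n)
    (Xnm : L.space m →L[ℂ] L.space n) (hrep : L.IsRep X.map Xnm) (lam : ℝ)
    (hbij : Function.Bijective fun f : L.space m =>
      Xnm f - (lam : ℂ) • Submodule.inclusion hmn f) :
    ∃ X₀ : L.space L.o →ₗ.[ℂ] L.space L.o,
      -- `X₀` is the operator determined by `X_{nm}`, and it is unique
      (LHS.Op.Determines Xnm lam X₀ ∧
        ∀ T : L.space L.o →ₗ.[ℂ] L.space L.o, LHS.Op.Determines Xnm lam T → T = X₀) ∧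
      Dense (X₀.domain : Set (L.space L.o)) ∧ IsSelfAdjoint X₀ ∧
      (lam : ℂ) ∉ X₀.hilbertSpectrum ∧
      -- one of the four cases holds
      ((m ≤ n ∧ n ≤ L.o ∧ L.o ≤ L.bar n ∧ L.bar n ≤ L.bar m) ∨
        (m ≤ L.bar n ∧ L.bar n ≤ L.o ∧ L.o ≤ n ∧ n ≤ L.bar m) ∨
        (L.bar n ≤ m ∧ m ≤ L.o ∧ L.o ≤ L.bar m ∧ L.bar m ≤ n) ∨
        (L.bar n ≤ L.bar m ∧ L.bar m ≤ L.o ∧ L.o ≤ m ∧ m ≤ n)) ∧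
      -- case (ia)
      (m ≤ n ∧ n ≤ L.o ∧ L.o ≤ L.bar n ∧ L.bar n ≤ L.bar m →
        X.IsObtainedByRestriction L.o (L.bar m) X₀ ∧
          ∀ f : L.space L.o, (f : V) ∈ L.space m → f ∈ X₀.domain) ∧
      -- case (ib)
      (m ≤ L.bar n ∧ L.bar n ≤ L.o ∧ L.o ≤ n ∧ n ≤ L.bar m →
        X.IsObtainedByRestriction (L.bar n) (L.bar m) X₀ ∧
          X.IsObtainedByRestriction m n X₀) ∧
      -- case (iia)
      (L.bar n ≤ m ∧ m ≤ L.o ∧ L.o ≤ L.bar m ∧ L.bar m ≤ n →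
        X.IsObtainedByRestriction (L.bar n) (L.bar m) X₀ ∧
          X.IsObtainedByRestriction m n X₀) ∧
      -- case (iib)
      (L.bar n ≤ L.bar m ∧ L.bar m ≤ L.o ∧ L.o ≤ m ∧ m ≤ n →
        X.IsObtainedByRestriction L.o n X₀) := by
  have hmn' : m ≤ n := (L.space_le _ _).2 hmn
  have hnm' : L.bar n ≤ L.bar m := L.bar_le_bar hmn'
  obtain ⟨R, hR⟩ := LHS.Op.exists_isInverseOfShift hmn Xnm lam hbij
  obtain ⟨S, hSrep, hS⟩ := hX m n Xnm hrep
  obtain ⟨Q, hQ⟩ := L.exists_adjoint R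
  have hSQ : LHS.Op.IsInverseOfShift S lam Q := hR.adjoint hmn' hS hQ
  obtain ⟨Roo, hsymm, hRn, hRm, hcases, hcenter, A, hAR, hAo⟩ :
      ∃ Roo : L.space L.o →L[ℂ] L.space L.o, (∀ f g, inner ℂ (Roo f) g = inner ℂ f (Roo g)) ∧
        (∀ (g : L.space L.o) (hg : (g : V) ∈ L.space n), (Roo g : V) = R ⟨g, hg⟩) ∧
        (∀ (g : L.space L.o) (hg : (g : V) ∈ L.space (L.bar m)), (Roo g : V) = Q ⟨g, hg⟩) ∧
        ((m ≤ n ∧ n ≤ L.o ∧ L.o ≤ L.bar n ∧ L.bar n ≤ L.bar m) ∨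
          (m ≤ L.bar n ∧ L.bar n ≤ L.o ∧ L.o ≤ n ∧ n ≤ L.bar m) ∨
          (L.bar n ≤ m ∧ m ≤ L.o ∧ L.o ≤ L.bar m ∧ L.bar m ≤ n) ∨
          (L.bar n ≤ L.bar m ∧ L.bar m ≤ L.o ∧ L.o ≤ m ∧ m ≤ n)) ∧
        (L.o ≤ n ∨ L.o ≤ L.bar m) ∧
        ∃ A : L.Op, L.IsRep A.map R ∧ L.IsRep A.map Roo := by
    rcases hchain.le_total n (L.bar m) with h | h
    · have h' : m ≤ L.bar n := L.le_of_bar_le_bar <| by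
        rw [L.space_le, L.space_bar_bar]; exact (L.space_le _ _).1 h
      have hRQ := LHS.Op.IsInverseOfShift.eq_of_le hrep hR hSrep hSQ h' h
      -- Here `Q` extends `R`: `⟨Rf|g⟩ = ⟨Qf|g⟩ = ⟨f|Rg⟩`. In the other branch `R` extends `Q`, and
      -- the roles are exchanged.
      have hsy : ∀ f g : L.space n, L.ip (R f : V) (g : V) = L.ip (f : V) (R g : V) := fun f g => by
        rw [← hRQ f, hQ, L.coe_incl]
      have ho : L.o ≤ L.bar m := by
        rcases hchain.le_total n L.o with hn | hn
        · exact (L.le_bar_of_le_center hn).trans hnm'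
        · exact hn.trans h
      obtain ⟨Roo, h1, h2, h3, A, hA1, -, hA3⟩ := LHS.Op.IsInverseOfShift.exists_center_restriction
        hrep hR hSrep hSQ h' h hmn' ho ((hchain.le_total n L.o).imp
          (fun hn => ⟨hn, L.le_bar_of_le_center hn⟩)
          fun hn => ⟨hn, h'.trans (L.bar_le_of_center_le hn)⟩) hsy
      refine ⟨Roo, h1, h3, fun g _ => h2 g, ?_, Or.inr ho, A, hA1, hA3⟩
      rcases hchain.le_total n L.o with hn | hn
      · exact Or.inl ⟨hmn', hn, L.le_bar_of_le_center hn, hnm'⟩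
      · exact Or.inr (Or.inl ⟨h', L.bar_le_of_center_le hn, hn, h⟩)
    · have h' : L.bar n ≤ m := L.le_of_bar_le_bar <| by
        rw [L.space_le, L.space_bar_bar]; exact (L.space_le _ _).1 h
      have hRQ := LHS.Op.IsInverseOfShift.eq_of_le hSrep hSQ hrep hR h' h
      have hsy : ∀ f g : L.space (L.bar m), L.ip (Q f : V) (g : V) = L.ip (f : V) (Q g : V) :=
        fun f g => by rw [← hRQ g, ← hQ, L.coe_incl]
      have hmo : L.bar m ≤ L.o → L.o ≤ m := fun hm =>
        L.le_of_bar_le_bar (hm.trans L.isLHS.bar_o.ge)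
      have ho : L.o ≤ n := by
        rcases hchain.le_total (L.bar m) L.o with hm | hm
        · exact (hmo hm).trans hmn'
        · exact hm.trans h
      have hom : L.o ≤ L.bar m → m ≤ L.o := fun hm =>
        L.le_of_bar_le_bar (L.isLHS.bar_o.le.trans hm)
      obtain ⟨Roo, h1, h2, h3, A, -, hA2, hA3⟩ := LHS.Op.IsInverseOfShift.exists_center_restriction
        hSrep hSQ hrep hR h' h hnm' ho ((hchain.le_total (L.bar m) L.o).imp
          (fun hm => ⟨hm, hmo hm⟩) fun hm => ⟨hm, h'.trans (hom hm)⟩) hsy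
      refine ⟨Roo, h1, fun g _ => h2 g, h3, ?_, Or.inl ho, A, hA2, hA3⟩
      rcases hchain.le_total (L.bar m) L.o with hm | hm
      · exact Or.inr (Or.inr (Or.inr ⟨hnm', hm, hmo hm, hmn'⟩))
      · exact Or.inr (Or.inr (Or.inl ⟨h', hom hm, hm, h⟩))
  have hinj : Function.Injective Roo := by
    intro f g e
    rcases hcenter with ho | ho
    all_goals have ho' := (L.space_le _ _).1 ho
    · have := hR.injective (Subtype.ext <|
        (hRn f (ho' f.2)).symm.trans ((congrArg Subtype.val e).trans (hRn g (ho' g.2))))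
      exact Subtype.ext (by simpa only [Subtype.mk.injEq] using this)
    · have := hSQ.injective (Subtype.ext <|
        (hRm f (ho' f.2)).symm.trans ((congrArg Subtype.val e).trans (hRm g (ho' g.2))))
      exact Subtype.ext (by simpa only [Subtype.mk.injEq] using this)
  set X₀ := LinearPMap.ofResolvent Roo hinj lam
  have hX₀ : X₀.IsResolventAt lam Roo := LinearPMap.isResolventAt_ofResolvent Roo hinj lam
  have hdet : LHS.Op.Determines Xnm lam X₀ := ⟨R, A, Roo, hR, hAR, hAo, hX₀⟩
  have hQres : ∀ (_ : L.o ≤ L.bar m) {r : J}, r ≤ L.bar n →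
      (∀ f ∈ L.space L.o, f ∈ L.space (L.bar n) → f ∈ L.space r) →
        X.IsObtainedByRestriction r (L.bar m) X₀ := fun ho _ hr hmem =>
    hSQ.isObtainedByRestriction hSrep ho hsymm (fun g => hRm g _) hX₀ hr hmem
  have hRres : ∀ (_ : L.o ≤ n) {r : J}, r ≤ m →
      (∀ f ∈ L.space L.o, f ∈ L.space m → f ∈ L.space r) →
        X.IsObtainedByRestriction r n X₀ := fun ho _ hr hmem =>
    hR.isObtainedByRestriction hrep ho hsymm (fun g => hRn g _) hX₀ hr hmem
  refine ⟨X₀, ⟨hdet, fun T hT => hT.unique hchain hdet⟩, hX₀.dense_domain hsymm,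
    hX₀.isSelfAdjoint hsymm, fun h => h ⟨Roo, hX₀⟩, hcases, ?_, ?_, ?_, ?_⟩
  · rintro ⟨-, hn, hno, -⟩
    have hres := hQres (hno.trans hnm') hno fun f hf _ => hf
    refine ⟨hres, fun f hf => ?_⟩
    have hdom := hres.2.2.2
    rw [← SetLike.mem_coe, hdom]
    -- `X` maps `V_m` into `V_n ⊆ V_o`, so `V_m` lies in the natural domain.
    exact ⟨f.2, _, (L.space_le _ _).1 hn (Xnm ⟨f, hf⟩).2, hrep ⟨f, hf⟩⟩
  · rintro ⟨-, -, hn, hnm⟩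
    exact ⟨hQres (hn.trans hnm) le_rfl fun _ _ hf => hf, hRres hn le_rfl fun _ _ hf => hf⟩
  · rintro ⟨-, -, hm, hnm⟩
    exact ⟨hQres hm le_rfl fun _ _ hf => hf, hRres (hm.trans hnm) le_rfl fun _ _ hf => hf⟩
  · rintro ⟨-, -, hm, -⟩
    exact hRres (hm.trans hmn') hm fun _ hf _ => hf
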